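/- Let $\mathbb R^4$ carry the metric $\eta=\mathrm{diag}(+,-,-,-)$, let $C_+=\{p\in\mathbb R^4: p_\mu p^\mu=0,\ p_0\ge 0\}$ carry the measure $d^3p/p_0$, and put $\hat f(p)=(2\pi)^{-2}\int e^{-ip\cdot x}f(x)\,d^4x$ with the Minkowski product $p\cdot x$. On the real vector space $\mathcal S(\mathbb R^4,\mathbb C^4)$ define the real bilinear form $D$ by $$iD(f,k)=-\pi\int_{C_+}\bigl(f_\mu\,\overline{k^\mu}-\overline{f_\mu}\,k^\mu\bigr)\frac{d^3p}{p_0},$$ let $\mathfrak Y=\mathcal S(\mathbb R^4,\mathbb C^4)/\mathrm{Ker}\,D$, and let $B$ be the symplectic form on $\mathfrak Y$ induced by $D$; elements of $\mathfrak Y$ are determined by their restrictions to $C_+$. For $t\in\mathbb R$ and $h\in\mathcal S(\mathbb R^4,\mathbb R)$ let $T_h^t\in\mathrm{Sp}(\mathfrak Y,B)$ be induced by $$(T_h^tf)_\mu(p)=f_\mu(p)-it\pi\,p_\mu\hat h(p)\int_{C_+}f^\nu(p')\,p'_\nu\,\overline{\hat h(p')}\,\frac{d^3p'}{p'_0},$$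 let $T_h=T_h^1$, and let $\mathcal G\subset\mathrm{Sp}(\mathfrak Y,B)$ be the group generated by all $T_h^t$. For a function or a space of functions on $\mathbb R^4$, passing to Fourier transforms and then to classes in $\mathfrak Y$ is denoted by $\rho$. Put $\mathfrak X=\rho(\mathcal S(\mathbb R^4,\mathbb R^4))$, $\mathfrak X_{(0)}=\rho(C_c^\infty(\mathbb R^4,\mathbb R^4))$, $\mathfrak Z=\mathrm{Span}_{\mathbb R}(\mathcal G(\mathfrak X))$, $\mathfrak Z_{(0)}=\mathfrak Z\cap\rho(C_c^\infty(\mathbb R^4,\mathbb C^4))$. For an open set $O\subseteq\mathbb R^4$ put $$\mathfrak Z(O)=\mathfrak Z\cap\rho\bigl(\{u\in\mathcal S(\mathbb R^4,\mathbb C^4):\mathrm{supp}\,u\subset O\}\bigr),\qquad \mathfrak p(O)=\{f\in\mathfrak Z(O): T_hf=f\ \ \forall h\in\mathcal S(\mathbb R^4,\mathbb R),\ \mathrm{supp}\,h\subset O\}.$$ Let $\Gamma$ be any family of bounded open subsets of $\mathbb R^4$ that is directed under inclusion, covers $\mathbb R^4$, and is mapped into itself by the proper orthochronous Poincaré group,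 and let $\mathfrak p=\mathrm{Span}_{\mathbb R}\bigcup_{O\in\Gamma}\mathfrak p(O)$. Let $$\mathfrak p_0=\{f\in\mathfrak p: B(f,k)=0\ \ \forall k\in\mathfrak p\}$$ be the kernel of $B$ restricted to $\mathfrak p$. Then: 1. $\mathfrak p_0$ is the set of all $f\in\mathfrak p$ for which there is a function $h:C_+\to\mathbb C$ such that $f_\mu(p)=p_\mu h(p)$ for all $p\in C_+$ and $p\mapsto p_\mu h(p)$ is (the restriction to $C_+$ of an element) in $\mathfrak Z_{(0)}$. Moreover every $h:C_+\to\mathbb C$ such that $p\mapsto p_\mu h(p)$ is in $\mathfrak Z_{(0)}$ occurs here: then $p\mapsto p_\mu h(p)$ is in $\mathfrak p_0$. 2. Let $\mathfrak f$ be the set of the smearing functions of Maxwell's equations $F_{\mu\nu}{}^{,\nu}=0$, i.e. of all $f\in\mathfrak X$ such that $f_\mu(p)=p_\mu p^\nu k_\nu(p)$ on $C_+$ for some $k\in\mathfrak X$. Then $\mathfrak f\cap\mathfrak Z_{(0)}\subseteq\mathfrak p_0$. In particular, for every $k\in\mathfrak X_{(0)}$ the function $p\mapsto p_\mu p^\nu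 k_\nu(p)$ is in $\mathfrak f\cap\mathfrak Z_{(0)}$, hence in $\mathfrak p_0$. -/

import Mathlib

open scoped SchwartzMap FourierTransform

noncomputable section

namespace GuptaBleuler

open MeasureTheory

/-! ### Minkowski space and the light cone -/

/-- `ℝ⁴`; the component `p i` is the contravariant component `p^i`, and `i = 0` is time. -/
abbrev Spacetime : Type := EuclideanSpace ℝ (Fin 4)

/-- The diagonal entries of the Minkowski metric `η = diag(+,-,-,-)`. -/
def eta (i : Fin 4) : ℝ := if i = 0 then 1 else -1

/-- The covariant components `p_i = η_{ii} p^i`. -/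
def lower (p : Spacetime) (i : Fin 4) : ℝ := eta i * p i

/-- The Minkowski product `p · x = p_μ x^μ`. -/
def mdot (p x : Spacetime) : ℝ := ∑ i, lower p i * x i

/-- The mantle `C₊ = {p | p_μ p^μ = 0, p_0 ≥ 0}` of the positive light cone. -/
def forwardCone : Set Spacetime := {p | mdot p p = 0 ∧ 0 ≤ p 0}

/-- The parametrization `𝐩 ↦ (‖𝐩‖, 𝐩)` of the cone by `ℝ³`. -/
def coneEmbed (q : EuclideanSpace ℝ (Fin 3)) : Spacetime :=
  WithLp.toLp 2 (Fin.cons ‖q‖ (fun i => q i))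

/-- The Lorentz invariant measure `d³p / p_0` on the cone, as a measure on `ℝ⁴`. -/
def coneMeasure : Measure Spacetime :=
  ((volume : Measure (EuclideanSpace ℝ (Fin 3))).withDensity
    (fun q => ENNReal.ofReal (1 / ‖q‖))).map coneEmbed

theorem eta_mul_self (i : Fin 4) : eta i * eta i = 1 := by
  unfold eta; split_ifs <;> norm_num

theorem coneEmbed_mem (q : EuclideanSpace ℝ (Fin 3)) : coneEmbed q ∈ forwardCone := by
  refine ⟨?_, by simp [coneEmbed]⟩
  have h := EuclideanSpace.real_norm_sq_eq q
  simp only [Fin.sum_univ_three] at h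
  simp [mdot, lower, eta, coneEmbed, Fin.sum_univ_succ, Fin.succ_ne_zero]
  simp only [← sq, h]
  ring

theorem exists_coneEmbed {p : Spacetime} (hp : p ∈ forwardCone) : ∃ q, coneEmbed q = p := by
  obtain ⟨h, h0⟩ := hp
  refine ⟨WithLp.toLp 2 (fun i => p i.succ), ?_⟩
  have hn : ‖(WithLp.toLp 2 (fun i : Fin 3 => p i.succ) : EuclideanSpace ℝ (Fin 3))‖ = p 0 := by
    rw [EuclideanSpace.norm_eq, Real.sqrt_eq_iff_mul_self_eq (by positivity) h0]
    simp [mdot, lower, eta, Fin.sum_univ_succ, Fin.succ_ne_zero] at h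
    simp [Fin.sum_univ_three]
    linarith
  ext i
  refine Fin.cases ?_ (fun j => ?_) i
  · simpa [coneEmbed] using hn
  · simp [coneEmbed]

theorem continuous_coneEmbed : Continuous coneEmbed := by
  refine (PiLp.continuous_toLp 2 _).comp (continuous_pi fun i => ?_)
  refine Fin.cases ?_ (fun j => ?_) i
  · simpa using continuous_norm
  · simp only [Fin.cons_succ]
    fun_prop

theorem norm_le_norm_coneEmbed (q : EuclideanSpace ℝ (Fin 3)) : ‖q‖ ≤ ‖coneEmbed q‖ := by
  have := PiLp.norm_apply_le (coneEmbed q) 0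
  simpa [coneEmbed] using this

instance : coneMeasure.HasTemperateGrowth := by
  refine ⟨4, ?_⟩
  have hm : Measurable fun q : EuclideanSpace ℝ (Fin 3) => ENNReal.ofReal (1 / ‖q‖) := by
    fun_prop
  unfold coneMeasure
  rw [integrable_map_measure (by
      refine Continuous.aestronglyMeasurable ?_
      refine Continuous.rpow_const (by fun_prop) fun x => Or.inl ?_
      positivity) continuous_coneEmbed.aemeasurable,
    integrable_withDensity_iff_integrable_smul₀' hm.aemeasurable
      (Filter.Eventually.of_forall fun _ => ENNReal.ofReal_lt_top)]
  have key : Integrable (fun q : EuclideanSpace ℝ (Fin 3) =>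
      (fun y : ℝ => y⁻¹ * (1 + y) ^ (-4 : ℝ)) ‖q‖) := by
    rw [integrable_fun_norm_addHaar (volume : Measure (EuclideanSpace ℝ (Fin 3)))
      (f := fun y : ℝ => y⁻¹ * (1 + y) ^ (-4 : ℝ))]
    have h1 : Integrable (fun y : ℝ => (1 + ‖y‖) ^ (-3 : ℝ)) :=
      integrable_one_add_norm (by simp)
    refine (h1.integrableOn (s := Set.Ioi 0)).mono' ?_ ?_
    · refine ContinuousOn.aestronglyMeasurable ?_ measurableSet_Ioi
      intro y hy
      have hy' : (0 : ℝ) < y := hy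
      refine ContinuousAt.continuousWithinAt ?_
      refine ContinuousAt.smul (f := fun y : ℝ => y ^ _) (by fun_prop) (ContinuousAt.mul ?_ ?_)
      · exact continuousAt_inv₀ hy'.ne'
      · exact ContinuousAt.rpow_const (by fun_prop) (Or.inl (by positivity))
    · refine (ae_restrict_iff' measurableSet_Ioi).2 (Filter.Eventually.of_forall fun y hy => ?_)
      have hy' : (0 : ℝ) < y := hy
      have h4 : (1 + y) ^ (-4 : ℝ) = (1 + y) ^ (-3 : ℝ) * (1 + y)⁻¹ := by
        rw [← Real.rpow_neg_one (1 + y), ← Real.rpow_add (by positivity)]; norm_num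
      have h3 : (0 : ℝ) < (1 + y) ^ (-3 : ℝ) := by positivity
      simp only [finrank_euclideanSpace, Fintype.card_fin, smul_eq_mul, Real.norm_eq_abs]
      rw [abs_of_nonneg (by positivity), abs_of_pos hy', h4]
      have : y ^ (3 - 1) * (y⁻¹ * ((1 + y) ^ (-3 : ℝ) * (1 + y)⁻¹))
          = (1 + y) ^ (-3 : ℝ) * (y / (1 + y)) := by
        field_simp
      rw [this]
      refine mul_le_of_le_one_right h3.le ?_
      rw [div_le_one (by positivity)]
      linarith
  refine key.mono' ?_ (Filter.Eventually.of_forall fun q => ?_)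
  · refine AEStronglyMeasurable.smul hm.ennreal_toReal.aestronglyMeasurable ?_
    refine (Continuous.comp ?_ continuous_coneEmbed).aestronglyMeasurable
    refine Continuous.rpow_const (by fun_prop) fun x => Or.inl ?_
    positivity
  · have h1 : (1 + ‖coneEmbed q‖) ^ (-4 : ℝ) ≤ (1 + ‖q‖) ^ (-4 : ℝ) :=
      Real.rpow_le_rpow_of_nonpos (by positivity)
        (by linarith [norm_le_norm_coneEmbed q]) (by norm_num)
    have h0 : (0 : ℝ) ≤ (1 + ‖coneEmbed q‖) ^ (-4 : ℝ) := by positivity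
    simp only [Function.comp, smul_eq_mul, Nat.cast_ofNat, norm_mul, Real.norm_eq_abs]
    rw [abs_of_nonneg h0, ENNReal.toReal_ofReal (by positivity), abs_of_nonneg (by positivity),
      one_div]
    gcongr

/-! ### Test functions and the presymplectic form -/

/-- Complex Schwartz functions `f` on momentum (or position) space with values in `ℂ⁴`; the entry
`f p i` is the covariant component `f_i(p)`. -/
abbrev VectorFn : Type := 𝓢(Spacetime, Fin 4 → ℂ)

/-- `∫_{C₊} f_μ(p) conj (k^μ(p)) d³p/p_0`. -/
def pairing (f k : VectorFn) : ℂ :=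
  ∫ p, ∑ i, (eta i : ℂ) * f p i * starRingEnd ℂ (k p i) ∂coneMeasure

/-- `D(f,k)`, determined by `i D(f,k) = -π ∫_{C₊} (f_μ conj k^μ - conj f_μ k^μ) d³p/p_0`. -/
def formD (f k : VectorFn) : ℝ :=
  (Complex.I * Real.pi * ∫ p, ∑ i, ((eta i : ℂ) * f p i * starRingEnd ℂ (k p i)
    - (eta i : ℂ) * starRingEnd ℂ (f p i) * k p i) ∂coneMeasure).re

theorem integrable_component (f : VectorFn) (i : Fin 4) :
    Integrable (fun p => f p i) coneMeasure :=
  (ContinuousLinearMap.proj (R := ℂ) (φ := fun _ : Fin 4 => ℂ) i).integrable_comp f.integrable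

theorem continuous_component (f : VectorFn) (i : Fin 4) : Continuous fun p => f p i :=
  (continuous_apply i).comp f.continuous

theorem integrable_mul_conj (f k : VectorFn) (i : Fin 4) :
    Integrable (fun p => (eta i : ℂ) * f p i * starRingEnd ℂ (k p i)) coneMeasure := by
  refine Integrable.mul_bdd (c := SchwartzMap.seminorm ℝ 0 0 k)
    ((integrable_component f i).const_mul _) ?_ ?_
  · exact (Complex.continuous_conj.comp (continuous_component k i)).aestronglyMeasurable
  · refine Filter.Eventually.of_forall fun p => ?_
    rw [RCLike.norm_conj]
    exact (norm_le_pi_norm (k p) i).trans (SchwartzMap.norm_le_seminorm ℝ k p)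

theorem integrable_pairing (f k : VectorFn) :
    Integrable (fun p => ∑ i, (eta i : ℂ) * f p i * starRingEnd ℂ (k p i)) coneMeasure :=
  integrable_finsetSum _ fun i _ => integrable_mul_conj f k i

theorem pairing_add_left (f g k : VectorFn) : pairing (f + g) k = pairing f k + pairing g k := by
  unfold pairing
  rw [← integral_add (integrable_pairing f k) (integrable_pairing g k)]
  refine integral_congr_ae (Filter.Eventually.of_forall fun p => ?_)
  simp only [add_apply, Pi.add_apply, ← Finset.sum_add_distrib]
  exact Finset.sum_congr rfl fun i _ => by ring

theorem pairing_smul_left (c : ℂ) (f k : VectorFn) : pairing (c • f) k = c * pairing f k := by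
  unfold pairing
  rw [← integral_const_mul]
  refine integral_congr_ae (Filter.Eventually.of_forall fun p => ?_)
  simp only [smul_apply, Pi.smul_apply, smul_eq_mul, Finset.mul_sum]
  exact Finset.sum_congr rfl fun i _ => by ring

theorem pairing_conj_symm (f k : VectorFn) : starRingEnd ℂ (pairing f k) = pairing k f := by
  unfold pairing
  rw [← integral_conj]
  refine integral_congr_ae (Filter.Eventually.of_forall fun p => ?_)
  simp only [map_sum, map_mul, Complex.conj_ofReal, Complex.conj_conj]
  exact Finset.sum_congr rfl fun i _ => by ring

theorem pairing_add_right (f k l : VectorFn) : pairing f (k + l) = pairing f k + pairing f l := by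
  rw [← pairing_conj_symm, pairing_add_left, map_add, pairing_conj_symm, pairing_conj_symm]

theorem pairing_smul_right (c : ℂ) (f k : VectorFn) :
    pairing f (c • k) = starRingEnd ℂ c * pairing f k := by
  rw [← pairing_conj_symm, pairing_smul_left, map_mul, pairing_conj_symm]

theorem integral_formD (f k : VectorFn) :
    ∫ p, ∑ i, ((eta i : ℂ) * f p i * starRingEnd ℂ (k p i)
      - (eta i : ℂ) * starRingEnd ℂ (f p i) * k p i) ∂coneMeasure
      = 2 * (pairing f k).im * Complex.I := by
  have h : pairing f k - pairing k f = 2 * (pairing f k).im * Complex.I := by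
    rw [← pairing_conj_symm f k, Complex.sub_conj]; push_cast; ring
  rw [← h]
  unfold pairing
  rw [← integral_sub (integrable_pairing f k) (integrable_pairing k f)]
  refine integral_congr_ae (Filter.Eventually.of_forall fun p => ?_)
  simp only [← Finset.sum_sub_distrib]
  exact Finset.sum_congr rfl fun i _ => by ring

theorem formD_eq (f k : VectorFn) : formD f k = -2 * Real.pi * (pairing f k).im := by
  unfold formD
  rw [integral_formD]
  simp
  ring

/-- The defining equation of `D`; in particular the right-hand side is purely imaginary. -/
theorem I_mul_formD (f k : VectorFn) :
    Complex.I * formD f k = -Real.pi * ∫ p, ∑ i, ((eta i : ℂ) * f p i * starRingEnd ℂ (k p i)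
      - (eta i : ℂ) * starRingEnd ℂ (f p i) * k p i) ∂coneMeasure := by
  rw [integral_formD, formD_eq]
  push_cast
  ring

theorem formD_swap (f k : VectorFn) : formD k f = -formD f k := by
  rw [formD_eq, formD_eq, ← pairing_conj_symm f k, Complex.conj_im]
  ring

theorem real_smul_eq (c : ℝ) (f : VectorFn) : c • f = (c : ℂ) • f := by
  ext p i
  simp

/-- The real bilinear form `D` on `𝓢(ℝ⁴, ℂ⁴)`. -/
def presymplecticForm : VectorFn →ₗ[ℝ] VectorFn →ₗ[ℝ] ℝ :=
  LinearMap.mk₂ ℝ formD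
    (fun f g k => by simp only [formD_eq, pairing_add_left, Complex.add_im]; ring)
    (fun c f k => by
      simp only [formD_eq, real_smul_eq, pairing_smul_left, Complex.im_ofReal_mul, smul_eq_mul]
      ring)
    (fun f k l => by simp only [formD_eq, pairing_add_right, Complex.add_im]; ring)
    (fun c f k => by
      simp only [formD_eq, real_smul_eq, pairing_smul_right, Complex.conj_ofReal,
        Complex.im_ofReal_mul, smul_eq_mul]
      ring)

@[simp] theorem presymplecticForm_apply (f k : VectorFn) : presymplecticForm f k = formD f k := rfl

/-- `Ker D = {f | D(f,k) = 0 for all k}`. -/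
def kerD : Submodule ℝ VectorFn := LinearMap.ker presymplecticForm

theorem mem_kerD {f : VectorFn} : f ∈ kerD ↔ ∀ k, formD f k = 0 := by
  simp [kerD, LinearMap.ext_iff]

theorem kerD_le_flip : kerD ≤ LinearMap.ker presymplecticForm.flip := fun f hf =>
  LinearMap.mem_ker.2 (LinearMap.ext fun k => by
    simp [formD_swap f k, mem_kerD.1 hf k])

/-- The symplectic space `𝔜 = 𝓢(ℝ⁴, ℂ⁴) / Ker D`. -/
abbrev SymplecticSpace : Type := VectorFn ⧸ kerD

/-- The symplectic form `B` on `𝔜` obtained from `D`. -/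
def formB : SymplecticSpace →ₗ[ℝ] SymplecticSpace →ₗ[ℝ] ℝ :=
  presymplecticForm.liftQ₂ kerD kerD le_rfl kerD_le_flip

@[simp] theorem formB_mk (f k : VectorFn) : formB (kerD.mkQ f) (kerD.mkQ k) = formD f k := rfl

/-! ### Restriction to the cone -/

/-- The restriction of `f` to the cone. -/
def restrictCone : VectorFn →ₗ[ℝ] (forwardCone → Fin 4 → ℂ) where
  toFun f p := f p
  map_add' _ _ := rfl
  map_smul' _ _ := rfl

/-- The function `f ↦ i f^μ` (indices raised by the metric). -/
def raiseI : (Fin 4 → ℂ) →L[ℂ] (Fin 4 → ℂ) :=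
  ContinuousLinearMap.pi fun i =>
    (Complex.I * (eta i : ℂ)) • ContinuousLinearMap.proj (R := ℂ) (φ := fun _ : Fin 4 => ℂ) i

theorem restrictCone_eq_zero_of_mem_kerD (f : VectorFn) (hf : f ∈ kerD) :
    restrictCone f = 0 := by
  set k : VectorFn := SchwartzMap.postcompCLM raiseI f with hk
  have h1 := mem_kerD.1 hf k
  have hpt : ∀ p, ∑ i, (eta i : ℂ) * f p i * starRingEnd ℂ (k p i)
      = ((-Complex.I) * ((∑ i, ‖f p i‖ ^ 2 : ℝ) : ℂ)) := by
    intro p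
    rw [Complex.ofReal_sum, Finset.mul_sum]
    refine Finset.sum_congr rfl fun i _ => ?_
    have he : (eta i : ℂ) * (eta i : ℂ) = 1 := by exact_mod_cast eta_mul_self i
    have hz : f p i * starRingEnd ℂ (f p i) = ((‖f p i‖ ^ 2 : ℝ) : ℂ) := by
      rw [Complex.mul_conj, Complex.normSq_eq_norm_sq]
    have : k p i = Complex.I * (eta i : ℂ) * f p i := by
      simp [hk, raiseI]
    rw [this, map_mul, map_mul, Complex.conj_I, Complex.conj_ofReal, ← hz]
    linear_combination (-Complex.I) * f p i * starRingEnd ℂ (f p i) * he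
  have hint : Integrable (fun p => ∑ i, ‖f p i‖ ^ 2) coneMeasure := by
    have := ((integrable_pairing f k).const_mul Complex.I).re
    refine this.congr (Filter.Eventually.of_forall fun p => ?_)
    simp only [hpt]
    rw [← mul_assoc, mul_neg, Complex.I_mul_I, neg_neg, one_mul]
    exact Complex.ofReal_re _
  have h2 : ∫ p, ∑ i, ‖f p i‖ ^ 2 ∂coneMeasure = 0 := by
    rw [formD_eq] at h1
    have h3 : (pairing f k).im = 0 := by
      have := Real.pi_ne_zero
      simpa [this] using h1
    unfold pairing at h3
    simp only [hpt] at h3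
    rw [integral_const_mul, integral_complex_ofReal] at h3
    simpa using h3
  have hcont : Continuous fun p => ∑ i, ‖f p i‖ ^ 2 :=
    continuous_finsetSum _ fun i _ => (continuous_component f i).norm.pow 2
  rw [integral_eq_zero_iff_of_nonneg (fun p => by positivity) hint] at h2
  have hm : Measurable fun q : EuclideanSpace ℝ (Fin 3) => ENNReal.ofReal (1 / ‖q‖) := by
    fun_prop
  have h3 : ∀ᵐ q : EuclideanSpace ℝ (Fin 3), ∑ i, ‖f (coneEmbed q) i‖ ^ 2 = 0 := by
    have h4 := ae_of_ae_map continuous_coneEmbed.aemeasurable h2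
    replace h4 := (ae_withDensity_iff hm).1 h4
    have h0 : ∀ᵐ q : EuclideanSpace ℝ (Fin 3), q ≠ 0 :=
      Measure.ae_ne volume 0
    filter_upwards [h4, h0] with q hq hq0
    refine hq ?_
    simpa using hq0
  have h5 := (Continuous.ae_eq_iff_eq volume (hcont.comp continuous_coneEmbed)
    continuous_const).1 h3
  funext p i
  obtain ⟨q, hq⟩ := exists_coneEmbed p.2
  have h6 := congrFun h5 q
  simp only [Function.comp, hq] at h6
  have := (Finset.sum_eq_zero_iff_of_nonneg fun i _ => by positivity).1 h6 i (Finset.mem_univ i)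
  simpa [restrictCone] using this

/-- The restriction to the cone `C₊` of an element of `𝔜`, with covariant components. -/
def onCone : SymplecticSpace →ₗ[ℝ] (forwardCone → Fin 4 → ℂ) :=
  kerD.liftQ restrictCone fun f hf => restrictCone_eq_zero_of_mem_kerD f hf

@[simp] theorem onCone_mk (f : VectorFn) (p : forwardCone) : onCone (kerD.mkQ f) p = f p := rfl

theorem formD_eq_of_restrictCone (f g k : VectorFn) (h : restrictCone f = restrictCone g) :
    formD f k = formD g k := by
  have hm : MeasurableSet {p : Spacetime | f p = g p} :=
    (isClosed_eq f.continuous g.continuous).measurableSet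
  have : ∀ᵐ p ∂coneMeasure, f p = g p := by
    unfold coneMeasure
    rw [ae_map_iff continuous_coneEmbed.aemeasurable hm]
    exact Filter.Eventually.of_forall fun q => congrFun h ⟨_, coneEmbed_mem q⟩
  rw [formD_eq, formD_eq]
  unfold pairing
  rw [integral_congr_ae (g := fun p => ∑ i, (eta i : ℂ) * g p i * starRingEnd ℂ (k p i))
    (this.mono fun p hp => by simp only [hp])]

/-- An element of `𝔜` is determined by its restriction to the cone. -/
theorem onCone_injective : Function.Injective onCone := by
  rw [← LinearMap.ker_eq_bot, LinearMap.ker_eq_bot']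
  intro x hx
  obtain ⟨f, rfl⟩ := kerD.mkQ_surjective x
  rw [Submodule.mkQ_apply, Submodule.Quotient.mk_eq_zero]
  refine mem_kerD.2 fun k => ?_
  rw [formD_eq_of_restrictCone f 0 k hx]
  simp [formD]

/-- `𝔜` with `B` is symplectic: `B` is nondegenerate. -/
theorem formB_nondegenerate (x : SymplecticSpace) (hx : ∀ y, formB x y = 0) : x = 0 := by
  obtain ⟨f, rfl⟩ := kerD.mkQ_surjective x
  rw [Submodule.mkQ_apply, Submodule.Quotient.mk_eq_zero]
  exact mem_kerD.2 fun k => hx (kerD.mkQ k)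

/-! ### Fourier transform, gradients and gauge transformations -/

/-- The linear change of variables `p ↦ η p / 2π`. -/
def fourierScale : Spacetime ≃L[ℝ] Spacetime :=
  LinearEquiv.toContinuousLinearEquiv
    { toFun := fun p => WithLp.toLp 2 fun i => (2 * Real.pi)⁻¹ * lower p i
      invFun := fun p => WithLp.toLp 2 fun i => 2 * Real.pi * lower p i
      map_add' := fun p q => by
        ext i
        simp [lower]
        ring
      map_smul' := fun c p => by
        ext i
        simp [lower]
        ring
      left_inv := fun p => by
        ext i
        have := eta_mul_self i
        have h2 := Real.pi_ne_zero
        simp only [lower]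
        field_simp
        linear_combination (p i) * this
      right_inv := fun p => by
        ext i
        have := eta_mul_self i
        have h2 := Real.pi_ne_zero
        simp only [lower]
        field_simp
        linear_combination (p i) * this }

section Fourier

variable {F : Type*} [NormedAddCommGroup F] [NormedSpace ℂ F]

/-- The Fourier transform `f̂(p) = (2π)⁻² ∫ e^{-i p·x} f(x) d⁴x` with the Minkowski product `p·x`;
see `minkFourier_apply`. -/
def minkFourier : 𝓢(Spacetime, F) →ₗ[ℂ] 𝓢(Spacetime, F) :=
  (((2 * Real.pi : ℂ) ^ 2)⁻¹) • ((SchwartzMap.compCLMOfContinuousLinearEquiv ℂ fourierScale).comp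
    (SchwartzMap.fourierTransformCLM ℂ)).toLinearMap

theorem minkFourier_apply (f : 𝓢(Spacetime, F)) (p : Spacetime) :
    minkFourier f p = (((2 * Real.pi : ℂ) ^ 2)⁻¹) •
      ∫ x, Complex.exp (-Complex.I * mdot p x) • f x := by
  have h : minkFourier f p = (((2 * Real.pi : ℂ) ^ 2)⁻¹) • 𝓕 (f : Spacetime → F) (fourierScale p) :=
    rfl
  rw [h, Real.fourier_eq']
  congr 1
  refine integral_congr_ae (Filter.Eventually.of_forall fun x => ?_)
  have h2 : -2 * Real.pi * inner ℝ x (fourierScale p) = - mdot p x := by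
    have h3 : ∀ i, fourierScale p i = (2 * Real.pi)⁻¹ * lower p i := fun i => rfl
    have h4 := Real.pi_ne_zero
    simp only [PiLp.inner_apply, h3, mdot, Finset.mul_sum, ← Finset.sum_neg_distrib]
    refine Finset.sum_congr rfl fun i _ => ?_
    simp
    field_simp
  simp only
  rw [h2]
  congr 2
  push_cast
  ring

end Fourier

/-- A real scalar Schwartz function, regarded as complex valued. -/
def complexify (h : 𝓢(Spacetime, ℝ)) : 𝓢(Spacetime, ℂ) :=
  SchwartzMap.postcompCLM Complex.ofRealCLM h

/-- A real vector valued Schwartz function, regarded as complex valued. -/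
def complexifyVec : 𝓢(Spacetime, Fin 4 → ℝ) →ₗ[ℝ] VectorFn :=
  (SchwartzMap.postcompCLM (ContinuousLinearMap.pi fun i =>
    Complex.ofRealCLM.comp (ContinuousLinearMap.proj (R := ℝ) (φ := fun _ : Fin 4 => ℝ) i))).toLinearMap

@[simp] theorem complexify_apply (h : 𝓢(Spacetime, ℝ)) (x : Spacetime) :
    complexify h x = (h x : ℂ) := rfl

@[simp] theorem complexifyVec_apply (u : 𝓢(Spacetime, Fin 4 → ℝ)) (x : Spacetime) (i : Fin 4) :
    complexifyVec u x i = (u x i : ℂ) := rfl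

/-- The covariant momentum `p ↦ (p_μ)_μ` as a continuous linear map. -/
def lowerCLM : Spacetime →L[ℝ] (Fin 4 → ℂ) :=
  ContinuousLinearMap.pi fun i =>
    Complex.ofRealCLM.comp (eta i • (EuclideanSpace.proj i : Spacetime →L[ℝ] ℝ))

/-- The Schwartz function `p ↦ p_μ φ(p)`. -/
def momentumMul (φ : 𝓢(Spacetime, ℂ)) : VectorFn :=
  SchwartzMap.bilinLeftCLM (𝕜 := ℝ) (ContinuousLinearMap.lsmul ℝ ℂ) lowerCLM.hasTemperateGrowth φ

@[simp] theorem momentumMul_apply (φ : 𝓢(Spacetime, ℂ)) (p : Spacetime) (i : Fin 4) :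
    momentumMul φ p i = (lower p i : ℂ) * φ p := by
  simp [momentumMul, lowerCLM, lower, mul_comm]

/-- `c(f,h) = ∫_{C₊} f^ν(p) p_ν conj (ĥ(p)) d³p/p_0`. -/
def gaugeCoeff (f : VectorFn) (h : 𝓢(Spacetime, ℝ)) : ℂ :=
  ∫ p, (∑ i, (eta i : ℂ) * f p i * (lower p i : ℂ)) *
    starRingEnd ℂ (minkFourier (complexify h) p) ∂coneMeasure

theorem gaugeCoeff_eq (f : VectorFn) (h : 𝓢(Spacetime, ℝ)) :
    gaugeCoeff f h = pairing f (momentumMul (minkFourier (complexify h))) := by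
  unfold gaugeCoeff pairing
  refine integral_congr_ae (Filter.Eventually.of_forall fun p => ?_)
  simp only [momentumMul_apply, map_mul, Complex.conj_ofReal, Finset.sum_mul]
  exact Finset.sum_congr rfl fun i _ => by ring

/-- The gauge transformation
`(T_h^t f)_μ(p) = f_μ(p) - i t π p_μ ĥ(p) ∫_{C₊} f^ν(p') p'_ν conj (ĥ(p')) d³p'/p'_0`
on `𝓢(ℝ⁴, ℂ⁴)`. -/
def gaugeFn (t : ℝ) (h : 𝓢(Spacetime, ℝ)) : VectorFn →ₗ[ℝ] VectorFn where
  toFun f := f - (Complex.I * t * Real.pi * gaugeCoeff f h) •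
    momentumMul (minkFourier (complexify h))
  map_add' f g := by
    simp only [gaugeCoeff_eq, pairing_add_left]
    module
  map_smul' c f := by
    simp only [gaugeCoeff_eq, real_smul_eq, pairing_smul_left, RingHom.id_apply]
    module

theorem gaugeFn_apply (t : ℝ) (h : 𝓢(Spacetime, ℝ)) (f : VectorFn) (p : Spacetime) (i : Fin 4) :
    gaugeFn t h f p i = f p i - Complex.I * t * Real.pi * (lower p i : ℂ) *
      minkFourier (complexify h) p * gaugeCoeff f h := by
  simp [gaugeFn]
  ring

theorem pairing_gradient (φ ψ : 𝓢(Spacetime, ℂ)) :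
    pairing (momentumMul φ) (momentumMul ψ) = 0 := by
  have hm : MeasurableSet {p : Spacetime | mdot p p = 0} := by
    refine (isClosed_eq ?_ continuous_const).measurableSet
    unfold mdot lower
    fun_prop
  have hae : ∀ᵐ p ∂coneMeasure, mdot p p = 0 := by
    unfold coneMeasure
    rw [ae_map_iff continuous_coneEmbed.aemeasurable hm]
    exact Filter.Eventually.of_forall fun q => (coneEmbed_mem q).1
  unfold pairing
  rw [integral_congr_ae (g := fun _ => (0 : ℂ)), integral_zero]
  filter_upwards [hae] with p hp
  have : ∑ i, (eta i : ℂ) * momentumMul φ p i * starRingEnd ℂ (momentumMul ψ p i)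
      = (mdot p p : ℂ) * (φ p * starRingEnd ℂ (ψ p)) := by
    unfold mdot
    rw [Complex.ofReal_sum, Finset.sum_mul]
    refine Finset.sum_congr rfl fun i _ => ?_
    have he : (eta i : ℂ) * (eta i : ℂ) = 1 := by exact_mod_cast eta_mul_self i
    simp only [momentumMul_apply, lower, map_mul, Complex.conj_ofReal]
    push_cast
    linear_combination (eta i : ℂ) * p i * p i * φ p * starRingEnd ℂ (ψ p) * he
  rw [this, hp]
  simp

theorem formD_gaugeFn (t : ℝ) (h : 𝓢(Spacetime, ℝ)) (f k : VectorFn) :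
    formD (gaugeFn t h f) (gaugeFn t h k) = formD f k := by
  have hsub : ∀ (c : ℂ) (f g : VectorFn), f - c • g = f + (-c) • g := fun c f g => by module
  simp only [formD_eq, gaugeFn, LinearMap.coe_mk, AddHom.coe_mk, gaugeCoeff_eq, hsub,
    pairing_add_left, pairing_add_right, pairing_smul_left, pairing_smul_right, pairing_gradient]
  rw [← pairing_conj_symm k (momentumMul (minkFourier (complexify h)))]
  generalize pairing f (momentumMul (minkFourier (complexify h))) = a
  generalize pairing k (momentumMul (minkFourier (complexify h))) = b
  simp
  ring

theorem gaugeFn_gaugeFn_neg (t : ℝ) (h : 𝓢(Spacetime, ℝ)) (f : VectorFn) :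
    gaugeFn t h (gaugeFn (-t) h f) = f := by
  have hsub : ∀ (c : ℂ) (f g : VectorFn), f - c • g = f + (-c) • g := fun c f g => by module
  simp only [gaugeFn, LinearMap.coe_mk, AddHom.coe_mk, gaugeCoeff_eq, hsub,
    pairing_add_left, pairing_smul_left, pairing_gradient]
  push_cast
  module

theorem kerD_le_comap_gaugeFn (t : ℝ) (h : 𝓢(Spacetime, ℝ)) :
    kerD ≤ kerD.comap (gaugeFn t h) := fun f hf => by
  rw [Submodule.mem_comap, mem_kerD]
  intro k
  have hk : gaugeFn t h (gaugeFn (-t) h k) = k := gaugeFn_gaugeFn_neg t h k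
  rw [← hk, formD_gaugeFn]
  exact mem_kerD.1 hf _

theorem gauge_aux (t : ℝ) (h : 𝓢(Spacetime, ℝ)) :
    (kerD.mapQ kerD (gaugeFn t h) (kerD_le_comap_gaugeFn t h)).comp
      (kerD.mapQ kerD (gaugeFn (-t) h) (kerD_le_comap_gaugeFn (-t) h)) = LinearMap.id := by
  refine LinearMap.ext fun x => ?_
  obtain ⟨f, rfl⟩ := kerD.mkQ_surjective x
  simp [gaugeFn_gaugeFn_neg]

/-- The gauge transformation `T_h^t` on `𝔜`. -/
def gauge (t : ℝ) (h : 𝓢(Spacetime, ℝ)) : SymplecticSpace ≃ₗ[ℝ] SymplecticSpace :=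
  LinearEquiv.ofLinearMap (kerD.mapQ kerD (gaugeFn t h) (kerD_le_comap_gaugeFn t h))
    (kerD.mapQ kerD (gaugeFn (-t) h) (kerD_le_comap_gaugeFn (-t) h))
    (gauge_aux t h) (by simpa using gauge_aux (-t) h)

@[simp] theorem gauge_mk (t : ℝ) (h : 𝓢(Spacetime, ℝ)) (f : VectorFn) :
    gauge t h (kerD.mkQ f) = kerD.mkQ (gaugeFn t h f) := rfl

/-- The symplectic group `Sp(𝔜, B)`. -/
def symplecticGroup : Subgroup (SymplecticSpace ≃ₗ[ℝ] SymplecticSpace) where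
  carrier := {γ | ∀ x y, formB (γ x) (γ y) = formB x y}
  mul_mem' := fun {a b} ha hb x y => by
    rw [LinearEquiv.mul_apply, LinearEquiv.mul_apply, ha, hb]
  one_mem' := fun _ _ => rfl
  inv_mem' := fun {a} ha x y => by
    rw [← ha (a⁻¹ x) (a⁻¹ y)]
    simp

theorem gauge_mem (t : ℝ) (h : 𝓢(Spacetime, ℝ)) : gauge t h ∈ symplecticGroup := fun x y => by
  obtain ⟨f, rfl⟩ := kerD.mkQ_surjective x
  obtain ⟨k, rfl⟩ := kerD.mkQ_surjective y
  simp only [gauge_mk, formB_mk, formD_gaugeFn]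

/-- The group `𝒢` generated in `Sp(𝔜, B)` by all `T_h^t`. -/
def gaugeGroup : Subgroup symplecticGroup :=
  Subgroup.closure {γ | ∃ t h, γ = ⟨gauge t h, gauge_mem t h⟩}

/-! ### The spaces of smearing functions -/

/-- The image in `𝔜` of the Fourier transform of `u`. -/
def rho (u : VectorFn) : SymplecticSpace := kerD.mkQ (minkFourier u)

/-- `𝔛`: the classes of Fourier transforms of real Schwartz functions `ℝ⁴ → ℝ⁴`. -/
def spaceX : Set SymplecticSpace := {f | ∃ u : 𝓢(Spacetime, Fin 4 → ℝ), f = rho (complexifyVec u)}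

/-- `ℨ`: the real span of the orbit of `𝔛` under the gauge group. -/
def spaceZ : Submodule ℝ SymplecticSpace :=
  Submodule.span ℝ {f | ∃ γ ∈ gaugeGroup, ∃ g ∈ spaceX, f = γ.1 g}

/-- `ℨ(O)`: the elements of `ℨ` that are Fourier transforms of complex Schwartz functions
supported in `O`. -/
def spaceZLocal (O : Set Spacetime) : Set SymplecticSpace :=
  {f | (∃ u : VectorFn, tsupport u ⊆ O ∧ f = rho u) ∧ f ∈ spaceZ}

/-- `ℨ₍₀₎`: the elements of `ℨ` that are Fourier transforms of functions in `C_c^∞(ℝ⁴, ℂ⁴)`. -/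
def spaceZ₀ : Set SymplecticSpace :=
  {f | (∃ u : VectorFn, HasCompactSupport u ∧ f = rho u) ∧ f ∈ spaceZ}

/-- `𝔛₍₀₎`: the classes of Fourier transforms of functions in `C_c^∞(ℝ⁴, ℝ⁴)`. -/
def spaceX₀ : Set SymplecticSpace :=
  {f | ∃ u : 𝓢(Spacetime, Fin 4 → ℝ), HasCompactSupport u ∧ f = rho (complexifyVec u)}

/-- `𝔭(O)`: the elements of `ℨ(O)` fixed by `T_h` for all real `h` supported in `O`. -/
def spacePLocal (O : Set Spacetime) : Set SymplecticSpace :=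
  {f | f ∈ spaceZLocal O ∧ ∀ h : 𝓢(Spacetime, ℝ), tsupport h ⊆ O → gauge 1 h f = f}

/-- The proper orthochronous Lorentz group. -/
def IsLorentz (Λ : Matrix (Fin 4) (Fin 4) ℝ) : Prop :=
  Λ.transpose * Matrix.diagonal eta * Λ = Matrix.diagonal eta ∧ Λ.det = 1 ∧ 0 < Λ 0 0

/-- The Poincaré transformation `x ↦ Λ x + a`. -/
def poincare (Λ : Matrix (Fin 4) (Fin 4) ℝ) (a x : Spacetime) : Spacetime :=
  WithLp.toLp 2 (Λ.mulVec x.ofLp) + a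

/-- The admissible families of regions: directed sets of bounded open sets that cover `ℝ⁴` and are
preserved by proper orthochronous Poincaré transformations. -/
structure IsRegionNet (Γ : Set (Set Spacetime)) : Prop where
  isOpen : ∀ O ∈ Γ, IsOpen O
  isBounded : ∀ O ∈ Γ, Bornology.IsBounded O
  directed : DirectedOn (· ⊆ ·) Γ
  covers : ⋃₀ Γ = Set.univ
  invariant : ∀ O ∈ Γ, ∀ Λ a, IsLorentz Λ → poincare Λ a '' O ∈ Γ

/-- `𝔭`: the span of all `𝔭(O)`, `O ∈ Γ`. -/
def spaceP (Γ : Set (Set Spacetime)) : Submodule ℝ SymplecticSpace :=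
  Submodule.span ℝ (⋃ O ∈ Γ, spacePLocal O)

/-- `𝔭₀`: the kernel of the restriction of `B` to `𝔭`. -/
def spaceP₀ (Γ : Set (Set Spacetime)) : Set SymplecticSpace :=
  {f | f ∈ spaceP Γ ∧ ∀ k ∈ spaceP Γ, formB f k = 0}

/-- The function `p ↦ p_μ h(p)` on the cone. -/
def coneGradient (h : forwardCone → ℂ) : forwardCone → Fin 4 → ℂ :=
  fun p i => (lower p i : ℂ) * h p

/-- The function `p^ν k_ν(p)` on the cone. -/
def divergence (k : SymplecticSpace) : forwardCone → ℂ :=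
  fun p => ∑ i, ((p : Spacetime) i : ℂ) * onCone k p i

/-- `𝔣`: the smearing functions of the Maxwell equations, i.e. the `f ∈ 𝔛` with
`f_μ(p) = p_μ p^ν k_ν(p)` on the cone for some `k ∈ 𝔛`. -/
def maxwellSpace : Set SymplecticSpace :=
  {f | f ∈ spaceX ∧ ∃ k ∈ spaceX, onCone f = coneGradient (divergence k)}

end GuptaBleuler

end

open GuptaBleuler

open scoped LineDeriv

noncomputable section

namespace GuptaBleuler

open MeasureTheory

/-! ### The cone measure -/

/-! Everything reduces to the divergence `p^ν f_ν(p)` on the cone. The integral in `T_h` is the L²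
pairing of this divergence with `ĥ`, so divergence-free elements are fixed by every `T_h`.
Conversely, let `f` come from `u` supported in `O` and be fixed by all `T_h` with `supp h ⊆ O`. The
position-space divergence `w` of `u` is again supported in `O`, so its real and imaginary parts are
admissible choices of `h`; together they give `∫ |ŵ|² = 0` over the cone
(`divergence_eq_zero_of_mem_spacePLocal`). Since a compact set lies in a single member of `Γ`, it
follows that `𝔭` is exactly the divergence-free part of `ℨ₍₀₎` (`mem_spaceP_iff`).

A gradient `p_μ h` is divergence free because `p` is null, and it is `B`-orthogonal to every
divergence-free `k` because `p_μ k^μ` vanishes pointwise. This gives one inclusion and the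
statements on Maxwell's equations.

For the other inclusion, `f ∈ 𝔭₀` is tested against divergence-free curl fields of real, compactly
supported `F`. The result is `Re ∫ G conj F̂ = 0` for `G = p_b f_a - p_a f_b`. Such `F̂` determine
`G` away from the origin (`eq_zero_of_re_integral_mul_conj_eq_zero`): a real `F` only ties `F̂(p)`
to `F̂(-p)`, so on the forward cone alone `F̂` can be prescribed near any nonzero point. Hence `f`
is proportional to `p` off the apex, and continuity along rays settles the apex
(`eq_zero_at_origin`). -/

theorem isClosed_forwardCone : IsClosed forwardCone := by
  have h1 : IsClosed {p : Spacetime | mdot p p = 0} := by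
    refine isClosed_eq ?_ continuous_const
    unfold mdot lower
    fun_prop
  have h2 : IsClosed {p : Spacetime | 0 ≤ p 0} := isClosed_le continuous_const (by fun_prop)
  exact h1.inter h2

theorem ae_mem_forwardCone : ∀ᵐ p ∂coneMeasure, p ∈ forwardCone := by
  unfold coneMeasure
  refine (ae_map_iff continuous_coneEmbed.aemeasurable isClosed_forwardCone.measurableSet).2 ?_
  exact Filter.Eventually.of_forall coneEmbed_mem

/-- A continuous function that vanishes almost everywhere on the cone vanishes on the cone. -/
theorem eq_zero_on_forwardCone_of_ae {E : Type*} [NormedAddCommGroup E] {g : Spacetime → E}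
    (hg : Continuous g) (h : ∀ᵐ p ∂coneMeasure, g p = 0) {p : Spacetime} (hp : p ∈ forwardCone) :
    g p = 0 := by
  have hm : Measurable fun q : EuclideanSpace ℝ (Fin 3) => ENNReal.ofReal (1 / ‖q‖) := by
    fun_prop
  have h3 : ∀ᵐ q : EuclideanSpace ℝ (Fin 3), g (coneEmbed q) = 0 := by
    have h4 := ae_of_ae_map continuous_coneEmbed.aemeasurable h
    -- At `q = 0` the density takes the default value `0`, so nothing is known there; that point is
    -- Lebesgue null.
    replace h4 := (ae_withDensity_iff hm).1 h4
    filter_upwards [h4, Measure.ae_ne volume 0] with q hq hq0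
    refine hq ?_
    simpa using hq0
  have h5 := (Continuous.ae_eq_iff_eq volume (hg.comp continuous_coneEmbed)
    continuous_const).1 h3
  obtain ⟨q, rfl⟩ := exists_coneEmbed hp
  exact congrFun h5 q

theorem eq_zero_on_forwardCone_of_integral_eq_zero {g : Spacetime → ℝ} (hg : Continuous g)
    (hint : Integrable g coneMeasure) (hnn : ∀ p ∈ forwardCone, 0 ≤ g p)
    (h : ∫ p, g p ∂coneMeasure = 0) {p : Spacetime} (hp : p ∈ forwardCone) : g p = 0 :=
  eq_zero_on_forwardCone_of_ae hg
    ((integral_eq_zero_iff_of_nonneg_ae (ae_mem_forwardCone.mono hnn) hint).1 h) hp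

theorem integrable_mul_conj_schwartz (f g : 𝓢(Spacetime, ℂ)) :
    Integrable (fun p => f p * starRingEnd ℂ (g p)) coneMeasure := by
  refine Integrable.mul_bdd (c := SchwartzMap.seminorm ℝ 0 0 g) f.integrable ?_ ?_
  · exact (Complex.continuous_conj.comp g.continuous).aestronglyMeasurable
  · refine Filter.Eventually.of_forall fun p => ?_
    rw [RCLike.norm_conj]
    exact SchwartzMap.norm_le_seminorm ℝ g p

theorem eq_zero_on_forwardCone_of_integral_mul_conj_eq_zero (g : 𝓢(Spacetime, ℂ))
    (h : ∫ p, g p * starRingEnd ℂ (g p) ∂coneMeasure = 0) {p : Spacetime}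
    (hp : p ∈ forwardCone) : g p = 0 := by
  have hpt : ∀ p, g p * starRingEnd ℂ (g p) = ((‖g p‖ ^ 2 : ℝ) : ℂ) := fun p => by
    rw [Complex.mul_conj, Complex.normSq_eq_norm_sq]
  have hint := (integrable_mul_conj_schwartz g g).re
  simp only [hpt] at h hint
  rw [integral_complex_ofReal] at h
  have := eq_zero_on_forwardCone_of_integral_eq_zero (g := fun p => ‖g p‖ ^ 2)
    (g.continuous.norm.pow 2) hint (fun p _ => by positivity) (by exact_mod_cast h) hp
  simpa using this

theorem eq_zero_of_mem_forwardCone {p : Spacetime} (hp : p ∈ forwardCone) (h0 : p 0 = 0) :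
    p = 0 := by
  obtain ⟨q, rfl⟩ := exists_coneEmbed hp
  have hq : q = 0 := by simpa [coneEmbed] using h0
  subst hq
  ext i
  refine Fin.cases ?_ (fun j => ?_) i <;> simp [coneEmbed]

/-! ### Components and derivatives -/

/-- The `i`-th component of a vector valued Schwartz function. -/
def component {𝕜 : Type*} [RCLike 𝕜] (i : Fin 4) (f : 𝓢(Spacetime, Fin 4 → 𝕜)) : 𝓢(Spacetime, 𝕜) :=
  SchwartzMap.postcompCLM (ContinuousLinearMap.proj (R := 𝕜) (φ := fun _ : Fin 4 => 𝕜) i) f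

@[simp] theorem component_apply {𝕜 : Type*} [RCLike 𝕜] (i : Fin 4) (f : 𝓢(Spacetime, Fin 4 → 𝕜))
    (x : Spacetime) : component i f x = f x i := rfl

/-- The real vector valued Schwartz function with given components. -/
def ofComponents (φ : Fin 4 → 𝓢(Spacetime, ℝ)) : 𝓢(Spacetime, Fin 4 → ℝ) :=
  ∑ i, SchwartzMap.postcompCLM (ContinuousLinearMap.single ℝ (fun _ : Fin 4 => ℝ) i) (φ i)

@[simp] theorem ofComponents_apply (φ : Fin 4 → 𝓢(Spacetime, ℝ)) (x : Spacetime) (i : Fin 4) :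
    ofComponents φ x i = φ i x := by
  simp [ofComponents, Pi.single_apply]

theorem hasCompactSupport_ofComponents {φ : Fin 4 → 𝓢(Spacetime, ℝ)}
    (h : ∀ i, HasCompactSupport (φ i)) : HasCompactSupport (ofComponents φ) := by
  refine HasCompactSupport.intro (K := ⋃ i, tsupport (φ i)) (isCompact_iUnion h) fun x hx => ?_
  ext i
  rw [ofComponents_apply]
  exact image_eq_zero_of_notMem_tsupport fun hi => hx (Set.mem_iUnion.2 ⟨i, hi⟩)

theorem hasCompactSupport_complexifyVec {u : 𝓢(Spacetime, Fin 4 → ℝ)} (h : HasCompactSupport u) :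
    HasCompactSupport (complexifyVec u) := by
  refine h.mono' fun x hx => subset_tsupport _ fun h0 => hx ?_
  ext i
  simp [h0]

/-- The unit vector in direction `i`. -/
abbrev unitVec (i : Fin 4) : Spacetime := EuclideanSpace.single i 1

theorem lineDeriv_component {𝕜 : Type*} [RCLike 𝕜] (m : Spacetime) (i : Fin 4)
    (f : 𝓢(Spacetime, Fin 4 → 𝕜)) : ∂_{m} (component i f) = component i (∂_{m} f) := by
  ext x
  rw [component_apply, SchwartzMap.lineDerivOp_apply_eq_fderiv,
    SchwartzMap.lineDerivOp_apply_eq_fderiv]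
  have := hasFDerivAt_pi'.1 (f.hasFDerivAt x) i
  exact congrArg (fun L => L m) this.fderiv

theorem lineDeriv_complexify (m : Spacetime) (h : 𝓢(Spacetime, ℝ)) :
    ∂_{m} (complexify h) = complexify (∂_{m} h) := by
  ext x
  rw [complexify_apply, SchwartzMap.lineDerivOp_apply_eq_fderiv,
    SchwartzMap.lineDerivOp_apply_eq_fderiv]
  have := Complex.ofRealCLM.hasFDerivAt.comp x (h.hasFDerivAt x)
  exact congrArg (fun L => L m) this.fderiv

theorem hasCompactSupport_lineDeriv {F : Type*} [NormedAddCommGroup F] [NormedSpace ℝ F]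
    (m : Spacetime) {f : 𝓢(Spacetime, F)} (h : HasCompactSupport f) : HasCompactSupport (∂_{m} f : 𝓢(Spacetime, F)) :=
  h.mono' ((subset_tsupport _).trans (SchwartzMap.tsupport_lineDerivOp_subset m f))

/-! ### The Fourier transform -/

theorem minkFourier_eq {F : Type*} [NormedAddCommGroup F] [NormedSpace ℂ F]
    (f : 𝓢(Spacetime, F)) (p : Spacetime) :
    minkFourier f p = (((2 * Real.pi : ℂ) ^ 2)⁻¹) • (𝓕 f) (fourierScale p) := rfl

/-- The factor `2π` of Mathlib's transform cancels against `fourierScale`, whose metric factor makes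
the momentum covariant. -/
theorem minkFourier_lineDeriv (i : Fin 4) (f : 𝓢(Spacetime, ℂ)) (p : Spacetime) :
    minkFourier (∂_{unitVec i} f) p = Complex.I * (lower p i : ℂ) * minkFourier f p := by
  have hT : (inner ℝ · (unitVec i) : Spacetime → ℝ).HasTemperateGrowth :=
    ((innerSL ℝ).flip (unitVec i)).hasTemperateGrowth
  have h3 : fourierScale p i = (2 * Real.pi)⁻¹ * lower p i := rfl
  have h4 : (Real.pi : ℂ) ≠ 0 := by exact_mod_cast Real.pi_ne_zero
  rw [minkFourier_eq, minkFourier_eq, SchwartzMap.fourier_lineDerivOp_eq]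
  rw [smul_apply, SchwartzMap.smulLeftCLM_apply_apply hT, EuclideanSpace.inner_single_right, h3]
  simp
  field_simp

theorem integrable_exp_smul {F : Type*} [NormedAddCommGroup F] [NormedSpace ℂ F]
    (f : 𝓢(Spacetime, F)) (p : Spacetime) :
    Integrable fun x => Complex.exp (-Complex.I * mdot p x) • f x := by
  refine f.integrable.bdd_smul 1 ?_ (Filter.Eventually.of_forall fun x => ?_)
  · refine Continuous.aestronglyMeasurable ?_
    unfold mdot
    fun_prop
  · have : -Complex.I * mdot p x = ((-mdot p x : ℝ) : ℂ) * Complex.I := by push_cast; ring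
    rw [this, Complex.norm_exp_ofReal_mul_I]

theorem component_minkFourier (f : VectorFn) (i : Fin 4) :
    component i (minkFourier f) = minkFourier (component i f) := by
  ext p
  rw [component_apply, minkFourier_apply, minkFourier_apply, Pi.smul_apply]
  congr 1
  have := (ContinuousLinearMap.proj (R := ℂ) (φ := fun _ : Fin 4 => ℂ) i).integral_comp_comm
    (integrable_exp_smul f p)
  exact this.symm

theorem minkFourier_apply_component (f : VectorFn) (p : Spacetime) (i : Fin 4) :
    minkFourier f p i = minkFourier (component i f) p := by
  rw [← component_minkFourier, component_apply]

theorem minkFourier_ofComponents (φ : Fin 4 → 𝓢(Spacetime, ℝ)) (p : Spacetime) (i : Fin 4) :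
    minkFourier (complexifyVec (ofComponents φ)) p i = minkFourier (complexify (φ i)) p := by
  rw [minkFourier_apply_component]
  congr 2
  ext x
  simp

/-- Continuity from L¹ to the sup norm, needed to pass from compactly supported to Schwartz test
functions. -/
theorem norm_minkFourier_le (f : 𝓢(Spacetime, ℂ)) (p : Spacetime) :
    ‖minkFourier f p‖ ≤ ((2 * Real.pi) ^ 2)⁻¹ * ∫ x, ‖f x‖ := by
  rw [minkFourier_apply, norm_smul]
  have h : ‖((2 * Real.pi : ℂ) ^ 2)⁻¹‖ = ((2 * Real.pi) ^ 2)⁻¹ := by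
    simp [abs_of_pos Real.pi_pos]
  rw [h]
  gcongr
  refine (norm_integral_le_integral_norm _).trans_eq ?_
  refine integral_congr_ae (Filter.Eventually.of_forall fun x => ?_)
  have : -Complex.I * mdot p x = ((-mdot p x : ℝ) : ℂ) * Complex.I := by push_cast; ring
  simp only [norm_smul]
  rw [this, Complex.norm_exp_ofReal_mul_I, one_mul]

theorem minkFourier_surjective (φ : 𝓢(Spacetime, ℂ)) : ∃ Φ, minkFourier Φ = φ := by
  refine ⟨((2 * Real.pi : ℂ) ^ 2) • 𝓕⁻
    (SchwartzMap.compCLMOfContinuousLinearEquiv ℂ fourierScale.symm φ), ?_⟩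
  ext p
  have h4 : (Real.pi : ℂ) ≠ 0 := by exact_mod_cast Real.pi_ne_zero
  rw [map_smul, smul_apply, minkFourier_eq, FourierTransform.fourier_fourierInv_eq]
  simp [h4]

/-- Complex conjugation of Schwartz functions. -/
def conjFn (f : 𝓢(Spacetime, ℂ)) : 𝓢(Spacetime, ℂ) :=
  SchwartzMap.postcompCLM (Complex.conjCLE : ℂ →L[ℝ] ℂ) f

@[simp] theorem conjFn_apply (f : 𝓢(Spacetime, ℂ)) (x : Spacetime) :
    conjFn f x = starRingEnd ℂ (f x) := rfl

theorem minkFourier_conjFn (f : 𝓢(Spacetime, ℂ)) (p : Spacetime) :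
    minkFourier (conjFn f) p = starRingEnd ℂ (minkFourier f (-p)) := by
  rw [minkFourier_apply, minkFourier_apply, smul_eq_mul, smul_eq_mul, map_mul, ← integral_conj]
  congr 1
  · simp [map_ofNat]
  · refine integral_congr_ae (Filter.Eventually.of_forall fun x => ?_)
    simp only [smul_eq_mul, conjFn_apply, map_mul, ← Complex.exp_conj]
    congr 2
    simp [mdot, lower]

/-- Every Schwartz function that vanishes on the backward cone agrees on the forward cone with the
Fourier transform of a real function. -/
theorem exists_real_minkFourier_eq (φ : 𝓢(Spacetime, ℂ)) (hφ : ∀ p ∈ forwardCone, φ (-p) = 0) :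
    ∃ F : 𝓢(Spacetime, ℝ), ∀ p ∈ forwardCone, minkFourier (complexify F) p = φ p := by
  obtain ⟨Φ, rfl⟩ := minkFourier_surjective φ
  -- `2 Re Φ = Φ + conj Φ`, and the transform of `conj Φ` at `p` is `conj (φ (-p))`, which vanishes
  -- by assumption.
  refine ⟨(2 : ℝ) • SchwartzMap.postcompCLM Complex.reCLM Φ, fun p hp => ?_⟩
  have : complexify ((2 : ℝ) • SchwartzMap.postcompCLM Complex.reCLM Φ) = Φ + conjFn Φ := by
    ext x
    simp [Complex.add_conj]
  rw [this, map_add, add_apply, minkFourier_conjFn, hφ p hp]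
  simp

/-- `∂^i u_i`. -/
def fnDivergence {𝕜 : Type*} [RCLike 𝕜] (u : 𝓢(Spacetime, Fin 4 → 𝕜)) : 𝓢(Spacetime, 𝕜) :=
  ∑ i, eta i • ∂_{unitVec i} (component i u)

/-- Locality: the divergence of a field living in `O` may itself serve as a gauge function for `O`.
-/
theorem tsupport_fnDivergence {𝕜 : Type*} [RCLike 𝕜] (u : 𝓢(Spacetime, Fin 4 → 𝕜)) :
    tsupport (fnDivergence u) ⊆ tsupport u := by
  refine closure_minimal (fun x hx => ?_) (isClosed_tsupport _)
  by_contra h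
  refine hx ?_
  simp only [fnDivergence, sum_apply, smul_apply, lineDeriv_component, component_apply]
  refine Finset.sum_eq_zero fun i _ => ?_
  have h0 : (∂_{unitVec i} u : 𝓢(Spacetime, Fin 4 → 𝕜)) x = 0 :=
    image_eq_zero_of_notMem_tsupport fun hi => h (SchwartzMap.tsupport_lineDerivOp_subset _ _ hi)
  simp [h0]

theorem minkFourier_fnDivergence (u : VectorFn) (p : Spacetime) :
    minkFourier (fnDivergence u) p = Complex.I * ∑ i, (p i : ℂ) * minkFourier u p i := by
  simp only [fnDivergence, map_sum, sum_apply, Finset.mul_sum]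
  refine Finset.sum_congr rfl fun i _ => ?_
  have h : eta i • ∂_{unitVec i} (component i u)
      = (eta i : ℂ) • (∂_{unitVec i} (component i u) : 𝓢(Spacetime, ℂ)) := by
    ext x
    simp
  have he : (eta i : ℂ) * (eta i : ℂ) = 1 := by exact_mod_cast eta_mul_self i
  rw [h, map_smul, smul_apply, minkFourier_lineDeriv, minkFourier_apply_component, lower, smul_eq_mul]
  push_cast
  linear_combination Complex.I * p i * minkFourier (component i u) p * he

theorem complexify_fnDivergence (u : 𝓢(Spacetime, Fin 4 → ℝ)) :
    complexify (fnDivergence u) = fnDivergence (complexifyVec u) := by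
  have h : ∀ i, component i (complexifyVec u) = complexify (component i u) := fun i => by
    ext x
    simp
  ext x
  simp [fnDivergence, h, lineDeriv_complexify]

/-! ### Nondegeneracy for real test functions on the cone -/

/-- Smooth compactly supported functions are L¹-dense, and the integral is L¹-continuous in `F`,
because `F̂` is bounded by the L¹ norm of `F` and `G` is integrable on the cone. -/
theorem re_integral_mul_conj_minkFourier_eq_zero {G : 𝓢(Spacetime, ℂ)}
    (hG : ∀ F : 𝓢(Spacetime, ℝ), HasCompactSupport F →
      (∫ p, G p * starRingEnd ℂ (minkFourier (complexify F) p) ∂coneMeasure).re = 0)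
    (F : 𝓢(Spacetime, ℝ)) :
    (∫ p, G p * starRingEnd ℂ (minkFourier (complexify F) p) ∂coneMeasure).re = 0 := by
  set C : ℝ := ((2 * Real.pi) ^ 2)⁻¹ * ∫ p, ‖G p‖ ∂coneMeasure with hC
  have hC0 : 0 ≤ C := by positivity
  set z : ℂ := ∫ p, G p * starRingEnd ℂ (minkFourier (complexify F) p) ∂coneMeasure with hz
  have key : ∀ ε : ℝ, 0 < ε → |z.re| ≤ C * ε := by
    intro ε hε
    obtain ⟨g, hg1, hg2, hg3⟩ := (F.memLp 1 volume).exist_eLpNorm_sub_le (by simp) le_rfl hε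
    set H : 𝓢(Spacetime, ℝ) := hg1.toSchwartzMap hg2 with hH
    have hHF : ∫ x, ‖(F - H) x‖ ≤ ε := by
      have h1 : eLpNorm (F - H : 𝓢(Spacetime, ℝ)) 1 volume ≤ ENNReal.ofReal ε := hg3
      rw [eLpNorm_one_eq_lintegral_enorm] at h1
      rw [integral_norm_eq_lintegral_enorm (F - H).continuous.aestronglyMeasurable]
      exact ENNReal.toReal_le_of_le_ofReal hε.le h1
    have hsub : minkFourier (complexify (F - H))
        = minkFourier (complexify F) - minkFourier (complexify H) := by
      rw [← map_sub]
      congr 1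
      ext x
      simp
    have hzsub : z - ∫ p, G p * starRingEnd ℂ (minkFourier (complexify H) p) ∂coneMeasure
        = ∫ p, G p * starRingEnd ℂ (minkFourier (complexify (F - H)) p) ∂coneMeasure := by
      rw [hz, ← integral_sub (integrable_mul_conj_schwartz _ _) (integrable_mul_conj_schwartz _ _)]
      refine integral_congr_ae (Filter.Eventually.of_forall fun p => ?_)
      simp only [hsub, sub_apply, map_sub]
      ring
    have hre : z.re
        = (∫ p, G p * starRingEnd ℂ (minkFourier (complexify (F - H)) p) ∂coneMeasure).re := by
      rw [← hzsub, Complex.sub_re, hG H hg1, sub_zero]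
    rw [hre]
    refine (Complex.abs_re_le_norm _).trans ((norm_integral_le_integral_norm _).trans ?_)
    have hle : ∫ p, ‖G p * starRingEnd ℂ (minkFourier (complexify (F - H)) p)‖ ∂coneMeasure
        ≤ ∫ p, ‖G p‖ * (((2 * Real.pi) ^ 2)⁻¹ * ε) ∂coneMeasure := by
      refine integral_mono (integrable_mul_conj_schwartz _ _).norm
        (G.integrable.norm.mul_const _) fun p => ?_
      simp only [norm_mul, RCLike.norm_conj]
      gcongr
      refine (norm_minkFourier_le _ _).trans ?_
      gcongr
      refine le_trans (le_of_eq ?_) hHF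
      refine integral_congr_ae (Filter.Eventually.of_forall fun x => ?_)
      simp only [complexify_apply, Complex.norm_real]
    refine hle.trans_eq ?_
    rw [integral_mul_const, hC]
    ring
  by_contra hne
  have hpos : 0 < |z.re| := abs_pos.2 hne
  -- `C + 1` instead of `C`, since `C` may be zero.
  have h1 := key (|z.re| / (2 * (C + 1))) (by positivity)
  have h2 : C * (|z.re| / (2 * (C + 1))) < |z.re| := by
    rw [mul_div_assoc', div_lt_iff₀ (by positivity)]
    nlinarith
  linarith

/-- Testing with `F̂ = χ G` on the forward cone, for a bump `χ` at `p₀`, gives `∫ χ |G|² = 0`. A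
real `F` with this transform exists if `χ` vanishes on the backward cone; this excludes the apex,
which lies on both cones. -/
theorem eq_zero_of_re_integral_mul_conj_eq_zero {G : 𝓢(Spacetime, ℂ)}
    (hG : ∀ F : 𝓢(Spacetime, ℝ), HasCompactSupport F →
      (∫ p, G p * starRingEnd ℂ (minkFourier (complexify F) p) ∂coneMeasure).re = 0)
    {p₀ : Spacetime} (hp₀ : p₀ ∈ forwardCone) (h0 : p₀ ≠ 0) : G p₀ = 0 := by
  have hpos : 0 < p₀ 0 := lt_of_le_of_ne hp₀.2 fun h => h0 (eq_zero_of_mem_forwardCone hp₀ h.symm)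
  -- The outer radius is `p₀ 0` because the time components alone keep every `-p` on the backward
  -- cone at least that far from `p₀`.
  let χ : ContDiffBump p₀ := ⟨p₀ 0 / 2, p₀ 0, by linarith, by linarith⟩
  have hχ : (χ : Spacetime → ℝ).HasTemperateGrowth := χ.hasCompactSupport.hasTemperateGrowth χ.contDiff
  set φ : 𝓢(Spacetime, ℂ) := SchwartzMap.smulLeftCLM ℂ (χ : Spacetime → ℝ) G with hφ
  have hφa : ∀ p, φ p = (χ p : ℂ) * G p := fun p => by
    rw [hφ, SchwartzMap.smulLeftCLM_apply_apply hχ, Complex.real_smul]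
  obtain ⟨F, hF⟩ := exists_real_minkFourier_eq φ fun p hp => by
    rw [hφa, χ.zero_of_le_dist, Complex.ofReal_zero, zero_mul]
    have h1 := PiLp.norm_apply_le (-p - p₀) 0
    rw [← dist_eq_norm] at h1
    refine le_trans ?_ h1
    have h2 : (-p - p₀) 0 = -(p 0 + p₀ 0) := by simp; ring
    rw [h2, norm_neg, Real.norm_eq_abs]
    exact le_trans (by linarith [hp.2]) (le_abs_self _)
  have h1 := re_integral_mul_conj_minkFourier_eq_zero hG F
  have h2 : ∫ p, G p * starRingEnd ℂ (minkFourier (complexify F) p) ∂coneMeasure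
      = ∫ p, G p * starRingEnd ℂ (φ p) ∂coneMeasure :=
    integral_congr_ae (ae_mem_forwardCone.mono fun p hp => by simp only [hF p hp])
  have hpt : ∀ p, G p * starRingEnd ℂ (φ p) = ((χ p * ‖G p‖ ^ 2 : ℝ) : ℂ) := fun p => by
    rw [hφa, map_mul, Complex.conj_ofReal, mul_left_comm, Complex.mul_conj,
      Complex.normSq_eq_norm_sq]
    push_cast
    ring
  have hint := (integrable_mul_conj_schwartz G φ).re
  rw [h2] at h1
  simp only [hpt] at h1 hint
  rw [integral_complex_ofReal, Complex.ofReal_re] at h1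
  have := eq_zero_on_forwardCone_of_integral_eq_zero (g := fun p => χ p * ‖G p‖ ^ 2)
    (χ.continuous.mul (G.continuous.norm.pow 2)) hint
    (fun p _ => mul_nonneg χ.nonneg (by positivity)) h1 hp₀
  have hχ1 : χ p₀ = 1 := χ.one_of_mem_closedBall (Metric.mem_closedBall_self χ.rIn_pos.le)
  simpa [hχ1] using this

/-! ### Gauge invariance and the divergence -/

theorem divergence_mk (f : VectorFn) (p : forwardCone) :
    divergence (kerD.mkQ f) p = ∑ i, ((p : Spacetime) i : ℂ) * f p i := rfl

theorem divergence_add (f g : SymplecticSpace) :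
    divergence (f + g) = divergence f + divergence g := by
  funext p
  simp [divergence, mul_add, Finset.sum_add_distrib]

theorem divergence_smul (c : ℝ) (f : SymplecticSpace) :
    divergence (c • f) = c • divergence f := by
  funext p
  simp [divergence, Finset.mul_sum, mul_left_comm]

theorem divergence_eq_zero_of_coneGradient {f : SymplecticSpace} {h : forwardCone → ℂ}
    (hf : onCone f = coneGradient h) : divergence f = 0 := by
  funext p
  have h1 : (mdot p p : ℂ) = 0 := by exact_mod_cast p.2.1
  unfold mdot at h1
  push_cast at h1
  simp only [divergence, hf, coneGradient, Pi.zero_apply]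
  calc _ = (∑ i, (lower p i : ℂ) * ((p : Spacetime) i : ℂ)) * h p := by
        rw [Finset.sum_mul]
        exact Finset.sum_congr rfl fun i _ => by ring
    _ = 0 := by rw [h1, zero_mul]

theorem eta_mul_lower (p : Spacetime) (i : Fin 4) : (eta i : ℂ) * (lower p i : ℂ) = (p i : ℂ) := by
  have : eta i * lower p i = p i := by
    rw [lower, ← mul_assoc, eta_mul_self, one_mul]
  exact_mod_cast this

theorem gaugeCoeff_eq_integral (f : VectorFn) (h : 𝓢(Spacetime, ℝ)) :
    gaugeCoeff f h = ∫ p, (∑ i, (p i : ℂ) * f p i) *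
      starRingEnd ℂ (minkFourier (complexify h) p) ∂coneMeasure := by
  unfold gaugeCoeff
  refine integral_congr_ae (Filter.Eventually.of_forall fun p => ?_)
  simp only [← eta_mul_lower]
  congr 1
  exact Finset.sum_congr rfl fun i _ => by ring

theorem gaugeCoeff_eq_zero_of_divergence_eq_zero {f : VectorFn}
    (hf : divergence (kerD.mkQ f) = 0) (h : 𝓢(Spacetime, ℝ)) : gaugeCoeff f h = 0 := by
  rw [gaugeCoeff_eq_integral]
  refine integral_eq_zero_of_ae (ae_mem_forwardCone.mono fun p hp => ?_)
  have := congrFun hf ⟨p, hp⟩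
  rw [divergence_mk] at this
  simp only [this, Pi.zero_apply, zero_mul]

theorem gauge_eq_self_of_divergence_eq_zero {f : SymplecticSpace} (hf : divergence f = 0) (t : ℝ)
    (h : 𝓢(Spacetime, ℝ)) : gauge t h f = f := by
  obtain ⟨f, rfl⟩ := kerD.mkQ_surjective f
  rw [gauge_mk]
  congr 1
  simp [gaugeFn, gaugeCoeff_eq_zero_of_divergence_eq_zero hf]

/-- If the coefficient were nonzero, invariance would force `p_μ ĥ(p) = 0` on the whole cone; but
then the integrand defining the coefficient vanishes. -/
theorem gaugeCoeff_eq_zero_of_gauge_eq_self {f : VectorFn} {h : 𝓢(Spacetime, ℝ)}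
    (hf : gauge 1 h (kerD.mkQ f) = kerD.mkQ f) : gaugeCoeff f h = 0 := by
  by_contra hc
  refine hc ?_
  rw [gauge_mk] at hf
  unfold gaugeCoeff
  refine integral_eq_zero_of_ae (ae_mem_forwardCone.mono fun p hp => ?_)
  have h1 : ∀ i, (lower p i : ℂ) * minkFourier (complexify h) p = 0 := fun i => by
    have := congrFun (congrFun (congrArg onCone hf) ⟨p, hp⟩) i
    rw [onCone_mk, onCone_mk, gaugeFn_apply, sub_eq_self] at this
    simpa [hc, Real.pi_ne_zero] using this
  rcases eq_or_ne (minkFourier (complexify h) p) 0 with h0 | h0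
  · simp [h0]
  · have h2 : ∀ i, (lower p i : ℂ) = 0 := fun i => (mul_eq_zero.1 (h1 i)).resolve_right h0
    simp only [h2, mul_zero, Finset.sum_const_zero, zero_mul, Pi.zero_apply]

theorem tsupport_postcompCLM_subset (L : ℂ →L[ℝ] ℝ) (w : 𝓢(Spacetime, ℂ)) :
    tsupport (SchwartzMap.postcompCLM L w) ⊆ tsupport w := by
  refine closure_mono fun x hx => ?_
  rw [Function.mem_support] at hx ⊢
  intro h0
  exact hx (by simp [h0])

/-- The divergence is tested against itself. Gauge functions must be real, so its real and imaginary
parts are used separately and recombined by linearity. -/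
theorem divergence_eq_zero_of_mem_spacePLocal {O : Set Spacetime} {f : SymplecticSpace}
    (hf : f ∈ spacePLocal O) : divergence f = 0 := by
  obtain ⟨⟨⟨u, hu, rfl⟩, -⟩, hT⟩ := hf
  set w : 𝓢(Spacetime, ℂ) := fnDivergence u with hw
  have hwsupp : tsupport w ⊆ O := (tsupport_fnDivergence u).trans hu
  have hpt : ∀ p, ∑ i, (p i : ℂ) * minkFourier u p i = -Complex.I * minkFourier w p := fun p => by
    rw [hw, minkFourier_fnDivergence, ← mul_assoc, neg_mul, Complex.I_mul_I, neg_neg, one_mul]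
  -- Used for `L = Re` and `L = Im`.
  have hreal : ∀ L : ℂ →L[ℝ] ℝ,
      ∫ p, minkFourier w p * starRingEnd ℂ
        (minkFourier (complexify (SchwartzMap.postcompCLM L w)) p) ∂coneMeasure = 0 := fun L => by
    have h1 := gaugeCoeff_eq_zero_of_gauge_eq_self (hT (SchwartzMap.postcompCLM L w)
      ((tsupport_postcompCLM_subset L w).trans hwsupp))
    rw [gaugeCoeff_eq_integral] at h1
    simp only [hpt, mul_assoc] at h1
    rw [integral_const_mul] at h1
    simpa using h1
  have hdec : minkFourier w = minkFourier (complexify (SchwartzMap.postcompCLM Complex.reCLM w))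
      + Complex.I • minkFourier (complexify (SchwartzMap.postcompCLM Complex.imCLM w)) := by
    rw [← map_smul, ← map_add]
    congr 1
    ext x
    simp [mul_comm Complex.I, Complex.re_add_im]
  have hzero : ∫ p, minkFourier w p * starRingEnd ℂ (minkFourier w p) ∂coneMeasure = 0 := by
    have h1 : ∀ p, minkFourier w p * starRingEnd ℂ (minkFourier w p)
        = minkFourier w p * starRingEnd ℂ
          (minkFourier (complexify (SchwartzMap.postcompCLM Complex.reCLM w)) p)
        + -Complex.I * (minkFourier w p * starRingEnd ℂ
          (minkFourier (complexify (SchwartzMap.postcompCLM Complex.imCLM w)) p)) := fun p => by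
      conv_lhs => rw [congrArg (fun v : 𝓢(Spacetime, ℂ) => starRingEnd ℂ (v p)) hdec]
      simp
      ring
    simp only [h1]
    rw [integral_add (integrable_mul_conj_schwartz _ _)
      ((integrable_mul_conj_schwartz _ _).const_mul _), integral_const_mul, hreal, hreal]
    simp
  funext p
  rw [rho, divergence_mk, hpt,
    eq_zero_on_forwardCone_of_integral_mul_conj_eq_zero _ hzero p.2, mul_zero, Pi.zero_apply]

/-! ### The space `𝔭` -/

/-- A finite subcover of `K` has an upper bound in `Γ` by directedness. -/
theorem IsRegionNet.exists_superset {Γ : Set (Set Spacetime)} (hΓ : IsRegionNet Γ)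
    {K : Set Spacetime} (hK : IsCompact K) : ∃ O ∈ Γ, K ⊆ O := by
  obtain ⟨O₀, hO₀, -⟩ : (0 : Spacetime) ∈ ⋃₀ Γ := hΓ.covers ▸ Set.mem_univ _
  have : Nonempty Γ := ⟨⟨O₀, hO₀⟩⟩
  obtain ⟨O, hO⟩ := hK.elim_directed_cover (fun O : Γ => (O : Set Spacetime))
    (fun O => hΓ.isOpen O O.2) (by rw [← Set.sUnion_eq_iUnion, hΓ.covers]; exact Set.subset_univ _)
    hΓ.directed.directed_val
  exact ⟨O, O.2, hO⟩

theorem mem_spaceZ₀_of_mem_spaceZLocal {O : Set Spacetime} (hO : Bornology.IsBounded O)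
    {f : SymplecticSpace} (hf : f ∈ spaceZLocal O) : f ∈ spaceZ₀ := by
  obtain ⟨⟨u, hu, rfl⟩, hZ⟩ := hf
  exact ⟨⟨u, Metric.isCompact_of_isClosed_isBounded (isClosed_tsupport _) (hO.subset hu), rfl⟩, hZ⟩

theorem rho_add (u v : VectorFn) : rho (u + v) = rho u + rho v := by
  simp only [rho, map_add]

theorem rho_smul (c : ℝ) (u : VectorFn) : rho (c • u) = c • rho u := by
  simp only [rho, real_smul_eq, map_smul]
  rw [← real_smul_eq, map_smul]

/-- `𝔭` consists of the divergence free elements of `ℨ₍₀₎`, whatever the family of regions. -/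
theorem mem_spaceP_iff {Γ : Set (Set Spacetime)} (hΓ : IsRegionNet Γ) {f : SymplecticSpace} :
    f ∈ spaceP Γ ↔ f ∈ spaceZ₀ ∧ divergence f = 0 := by
  constructor
  · intro hf
    refine Submodule.span_induction (p := fun f _ => f ∈ spaceZ₀ ∧ divergence f = 0)
      ?_ ?_ ?_ ?_ hf
    · intro x hx
      obtain ⟨O, hO, hx⟩ := Set.mem_iUnion₂.1 hx
      exact ⟨mem_spaceZ₀_of_mem_spaceZLocal (hΓ.isBounded O hO) hx.1,
        divergence_eq_zero_of_mem_spacePLocal hx⟩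
    · refine ⟨⟨⟨0, HasCompactSupport.zero, by simp [rho]⟩, zero_mem _⟩, ?_⟩
      simpa using divergence_smul 0 0
    · rintro x y - - ⟨⟨⟨u, hu, rfl⟩, hx⟩, hx0⟩ ⟨⟨⟨v, hv, rfl⟩, hy⟩, hy0⟩
      refine ⟨⟨⟨u + v, hu.add hv, (rho_add u v).symm⟩, add_mem hx hy⟩, ?_⟩
      rw [divergence_add, hx0, hy0, add_zero]
    · rintro c x - ⟨⟨⟨u, hu, rfl⟩, hx⟩, hx0⟩
      refine ⟨⟨⟨c • u, hu.smul_left (f := fun _ => c), (rho_smul c u).symm⟩,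
        Submodule.smul_mem _ _ hx⟩, ?_⟩
      rw [divergence_smul, hx0, smul_zero]
  · rintro ⟨⟨⟨u, hu, rfl⟩, hZ⟩, h0⟩
    obtain ⟨O, hO, hsub⟩ := hΓ.exists_superset hu
    exact Submodule.subset_span (Set.mem_iUnion₂.2 ⟨O, hO, ⟨⟨u, hsub, rfl⟩, hZ⟩,
      fun h _ => gauge_eq_self_of_divergence_eq_zero h0 1 h⟩)

theorem spaceX_subset_spaceZ {f : SymplecticSpace} (hf : f ∈ spaceX) : f ∈ spaceZ :=
  Submodule.subset_span ⟨1, one_mem _, f, hf, rfl⟩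

theorem rho_complexifyVec_mem_spaceZ₀ {u : 𝓢(Spacetime, Fin 4 → ℝ)} (hu : HasCompactSupport u) :
    rho (complexifyVec u) ∈ spaceZ₀ :=
  ⟨⟨_, hasCompactSupport_complexifyVec hu, rfl⟩, spaceX_subset_spaceZ ⟨u, rfl⟩⟩

/-! ### The kernel of `B` on `𝔭` -/

/-- Already the integrand of the pairing vanishes: it is `h` times the conjugate of the divergence
of `k`. -/
theorem formB_eq_zero_of_coneGradient {f k : SymplecticSpace} {h : forwardCone → ℂ}
    (hf : onCone f = coneGradient h) (hk : divergence k = 0) : formB f k = 0 := by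
  obtain ⟨f, rfl⟩ := kerD.mkQ_surjective f
  obtain ⟨k, rfl⟩ := kerD.mkQ_surjective k
  have h0 : pairing f k = 0 := by
    refine integral_eq_zero_of_ae (ae_mem_forwardCone.mono fun p hp => ?_)
    have hk0 := congrArg (starRingEnd ℂ) (congrFun hk ⟨p, hp⟩)
    rw [divergence_mk] at hk0
    simp only [map_sum, map_mul, Complex.conj_ofReal, Pi.zero_apply, map_zero] at hk0
    have hf' : ∀ i, f p i = (lower p i : ℂ) * h ⟨p, hp⟩ := fun i =>
      congrFun (congrFun hf ⟨p, hp⟩) i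
    simp only [hf', Pi.zero_apply, ← mul_assoc, eta_mul_lower]
    calc _ = h ⟨p, hp⟩ * ∑ i, (p i : ℂ) * starRingEnd ℂ (k p i) := by
          rw [Finset.mul_sum]
          exact Finset.sum_congr rfl fun i _ => by ring
      _ = 0 := by rw [hk0, mul_zero]
  rw [formB_mk, formD_eq, h0]
  simp

/-- The divergence free vector field `∂_b F e_a - ∂_a F e_b`, with indices raised. -/
def curlPotential (a b : Fin 4) (F : 𝓢(Spacetime, ℝ)) : 𝓢(Spacetime, Fin 4 → ℝ) :=
  ofComponents fun i => (if i = a then eta a else 0) • ∂_{unitVec b} F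
    - (if i = b then eta b else 0) • ∂_{unitVec a} F

theorem hasCompactSupport_curlPotential (a b : Fin 4) {F : 𝓢(Spacetime, ℝ)}
    (hF : HasCompactSupport F) : HasCompactSupport (curlPotential a b F) := by
  refine hasCompactSupport_ofComponents fun i => ?_
  refine HasCompactSupport.sub ?_ ?_
  · exact (hasCompactSupport_lineDeriv _ hF).smul_left (f := fun _ => _)
  · exact (hasCompactSupport_lineDeriv _ hF).smul_left (f := fun _ => _)

theorem minkFourier_curlPotential (a b : Fin 4) (F : 𝓢(Spacetime, ℝ)) (p : Spacetime) (i : Fin 4) :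
    minkFourier (complexifyVec (curlPotential a b F)) p i =
      Complex.I * minkFourier (complexify F) p *
        ((if i = a then (eta a : ℂ) * (lower p b : ℂ) else 0)
        - (if i = b then (eta b : ℂ) * (lower p a : ℂ) else 0)) := by
  have h : ∀ (c d : ℝ) (m n : Spacetime), complexify (c • ∂_{m} F - d • ∂_{n} F)
      = (c : ℂ) • ∂_{m} (complexify F) - (d : ℂ) • ∂_{n} (complexify F) := fun c d m n => by
    ext x
    simp [lineDeriv_complexify]
  rw [curlPotential, minkFourier_ofComponents, h, map_sub, map_smul, map_smul]
  simp only [sub_apply, smul_apply, minkFourier_lineDeriv, smul_eq_mul]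
  split_ifs <;> push_cast <;> ring

/-- Pairing `f` with a curl field moves the curl onto `f`, so orthogonality to all such fields says
that the momentum-space curl `G` of `f` annihilates every test function. -/
theorem curl_eq_zero_of_mem_spaceP₀ {Γ : Set (Set Spacetime)} (hΓ : IsRegionNet Γ) {f : VectorFn}
    (hf : kerD.mkQ f ∈ spaceP₀ Γ) (a b : Fin 4) {p : Spacetime} (hp : p ∈ forwardCone)
    (h0 : p ≠ 0) : (lower p b : ℂ) * f p a = (lower p a : ℂ) * f p b := by
  set G : 𝓢(Spacetime, ℂ) := component b (momentumMul (component a f))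
    - component a (momentumMul (component b f)) with hG
  have hGa : ∀ p, G p = (lower p b : ℂ) * f p a - (lower p a : ℂ) * f p b := fun p => by
    simp [hG]
  rw [← sub_eq_zero, ← hGa]
  refine eq_zero_of_re_integral_mul_conj_eq_zero (fun F hF => ?_) hp h0
  set k : VectorFn := minkFourier (complexifyVec (curlPotential a b F)) with hk
  have hkP : rho (complexifyVec (curlPotential a b F)) ∈ spaceP Γ := by
    refine (mem_spaceP_iff hΓ).2 ⟨rho_complexifyVec_mem_spaceZ₀
      (hasCompactSupport_curlPotential a b hF), ?_⟩
    funext q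
    rw [rho, divergence_mk]
    simp only [minkFourier_curlPotential, Pi.zero_apply, mul_sub, mul_ite, mul_zero,
      Finset.sum_sub_distrib, Finset.sum_ite_eq', Finset.mem_univ, if_true, lower]
    push_cast
    ring
  have h1 : formD f k = 0 := hf.2 _ hkP
  -- The factor `-i` comes from the single derivative in the curl; it turns the imaginary part in
  -- `formD` into the real part that the nondegeneracy lemma needs.
  have h2 : pairing f k = -Complex.I *
      ∫ p, G p * starRingEnd ℂ (minkFourier (complexify F) p) ∂coneMeasure := by
    rw [← integral_const_mul]
    refine integral_congr_ae (Filter.Eventually.of_forall fun p => ?_)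
    have he : ∀ i, (eta i : ℂ) * (eta i : ℂ) = 1 := fun i => by exact_mod_cast eta_mul_self i
    simp only [hk, minkFourier_curlPotential, hGa, map_mul, map_sub, apply_ite (starRingEnd ℂ),
      map_zero, Complex.conj_ofReal, Complex.conj_I, mul_sub, mul_ite, mul_zero,
      Finset.sum_sub_distrib, Finset.sum_ite_eq', Finset.mem_univ, if_true]
    set z := starRingEnd ℂ (minkFourier (complexify F) p)
    linear_combination (-Complex.I * z * f p a * (lower p b : ℂ)) * he a
      + (Complex.I * z * f p b * (lower p a : ℂ)) * he b
  rw [formD_eq, h2] at h1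
  simpa [Real.pi_ne_zero] using h1

/-- A continuous function on the cone proportional to `p` away from the origin vanishes there. -/
theorem eq_zero_at_origin {f : VectorFn} (hf : ∀ i, ∀ p ∈ forwardCone, p ≠ 0 →
    (lower p 0 : ℂ) * f p i = (lower p i : ℂ) * f p 0) (i : Fin 4) : f 0 i = 0 := by
  have h0 : coneEmbed 0 = 0 := by
    ext i
    refine Fin.cases ?_ (fun j => ?_) i <;> simp [coneEmbed]
  -- Limit of the proportionality along the ray `s ↦ s (1, e)` as `s → 0⁺`, after division by `s`.
  have key : ∀ (e : EuclideanSpace ℝ (Fin 3)) (j : Fin 3), ‖e‖ = 1 →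
      f 0 j.succ = -(e j : ℂ) * f 0 0 := by
    intro e j he
    have hc : Continuous fun s : ℝ => coneEmbed (s • e) :=
      continuous_coneEmbed.comp (by fun_prop)
    have hEq : Set.EqOn (fun s : ℝ => f (coneEmbed (s • e)) j.succ)
        (fun s : ℝ => -(e j : ℂ) * f (coneEmbed (s • e)) 0) (Set.Ioi 0) := by
      intro s hs
      have hs' : (0 : ℝ) < s := hs
      have hsc : (s : ℂ) ≠ 0 := by exact_mod_cast hs'.ne'
      have hl0 : lower (coneEmbed (s • e)) 0 = s := by
        simp [lower, eta, coneEmbed, norm_smul, he, abs_of_pos hs']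
      have hlj : lower (coneEmbed (s • e)) j.succ = -(s * e j) := by
        simp [lower, eta, coneEmbed, Fin.succ_ne_zero]
      have h1 := hf j.succ _ (coneEmbed_mem (s • e)) fun h => by
        rw [h] at hl0
        simp [lower] at hl0
        exact hs'.ne hl0
      rw [hl0, hlj] at h1
      push_cast at h1
      refine mul_left_cancel₀ hsc ?_
      simp only
      linear_combination h1
    have := (hEq.closure ((continuous_component f _).comp hc)
      (continuous_const.mul ((continuous_component f 0).comp hc)))
      (by rw [closure_Ioi]; exact Set.self_mem_Ici : (0 : ℝ) ∈ closure (Set.Ioi 0))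
    simpa [h0] using this
  -- Opposite directions give the same component of `f 0` with opposite signs, so `f 0 0 = 0`.
  have h1 := key (EuclideanSpace.single 0 1) 0 (by simp)
  have h2 := key (EuclideanSpace.single 0 (-1)) 0 (by simp)
  have h3 : f 0 0 = 0 := by
    simp at h1 h2
    rw [h1] at h2
    exact self_eq_neg.1 h2.symm
  refine Fin.cases h3 (fun j => ?_) i
  rw [key (EuclideanSpace.single 0 1) j (by simp), h3, mul_zero]

theorem exists_coneGradient_of_mem_spaceP₀ {Γ : Set (Set Spacetime)} (hΓ : IsRegionNet Γ)
    {f : SymplecticSpace} (hf : f ∈ spaceP₀ Γ) : ∃ h, onCone f = coneGradient h := by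
  obtain ⟨f, rfl⟩ := kerD.mkQ_surjective f
  have hcurl : ∀ i, ∀ p ∈ forwardCone, p ≠ 0 →
      (lower p 0 : ℂ) * f p i = (lower p i : ℂ) * f p 0 := fun i p hp h0 =>
    curl_eq_zero_of_mem_spaceP₀ hΓ hf i 0 hp h0
  -- The value at the apex is irrelevant, since there `p_μ = 0` and `f` vanishes.
  refine ⟨fun p => f p 0 / ((p : Spacetime) 0 : ℂ), ?_⟩
  funext p i
  rw [onCone_mk, coneGradient]
  rcases eq_or_ne (p : Spacetime) 0 with h0 | h0
  · rw [h0, eq_zero_at_origin hcurl]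
    simp [lower]
  · have hp0 : ((p : Spacetime) 0 : ℂ) ≠ 0 := by
      exact_mod_cast fun h => h0 (eq_zero_of_mem_forwardCone p.2 h)
    have h1 := hcurl i p p.2 h0
    have h2 : lower p 0 = (p : Spacetime) 0 := by simp [lower, eta]
    rw [h2] at h1
    field_simp
    linear_combination h1

/-! ### Maxwell's equations -/

/-- If `k` comes from `u`, then `-∂_μ ∂^ν u_ν` is real, compactly supported and has transform `p_μ
p^ν k_ν`: the two factors `i` cancel the sign. -/
theorem exists_mem_maxwellSpace {k : SymplecticSpace} (hk : k ∈ spaceX₀) :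
    ∃ f ∈ maxwellSpace ∩ spaceZ₀, onCone f = coneGradient (divergence k) := by
  obtain ⟨u, hu, rfl⟩ := hk
  set v : 𝓢(Spacetime, Fin 4 → ℝ) :=
    ofComponents fun i => (-1 : ℝ) • ∂_{unitVec i} (fnDivergence u) with hv
  have hvs : HasCompactSupport v := hasCompactSupport_ofComponents fun i =>
    (hasCompactSupport_lineDeriv _ (hu.mono' ((subset_tsupport _).trans
      (tsupport_fnDivergence u)))).smul_left (f := fun _ => _)
  have hc : onCone (rho (complexifyVec v)) = coneGradient (divergence (rho (complexifyVec u))) := by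
    funext p i
    have h : complexify ((-1 : ℝ) • ∂_{unitVec i} (fnDivergence u))
        = (-1 : ℂ) • ∂_{unitVec i} (fnDivergence (complexifyVec u)) := by
      rw [← complexify_fnDivergence, lineDeriv_complexify]
      ext x
      simp
    rw [coneGradient, rho, rho, onCone_mk, divergence_mk, hv, minkFourier_ofComponents, h, map_smul,
      smul_apply, minkFourier_lineDeriv, minkFourier_fnDivergence, smul_eq_mul]
    linear_combination (-(lower p i : ℂ) * ∑ j, ((p : Spacetime) j : ℂ) *
      minkFourier (complexifyVec u) p j) * Complex.I_mul_I
  exact ⟨_, ⟨⟨⟨v, rfl⟩, _, ⟨u, rfl⟩, hc⟩, rho_complexifyVec_mem_spaceZ₀ hvs⟩, hc⟩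

theorem mem_spaceP₀_of_coneGradient {Γ : Set (Set Spacetime)} (hΓ : IsRegionNet Γ)
    {f : SymplecticSpace} (hf : f ∈ spaceZ₀) {h : forwardCone → ℂ}
    (hh : onCone f = coneGradient h) : f ∈ spaceP₀ Γ :=
  ⟨(mem_spaceP_iff hΓ).2 ⟨hf, divergence_eq_zero_of_coneGradient hh⟩,
    fun _ hk => formB_eq_zero_of_coneGradient hh ((mem_spaceP_iff hΓ).1 hk).2⟩

end GuptaBleuler

end

theorem mainTheorem12 (Γ : Set (Set Spacetime)) (hΓ : IsRegionNet Γ) :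
    (spaceP₀ Γ = {f : SymplecticSpace | f ∈ spaceP Γ ∧
      ∃ h : forwardCone → ℂ, onCone f = coneGradient h ∧ coneGradient h ∈ onCone '' spaceZ₀}) ∧
    (∀ h : forwardCone → ℂ, coneGradient h ∈ onCone '' spaceZ₀ →
      coneGradient h ∈ onCone '' spaceP₀ Γ) ∧
    maxwellSpace ∩ spaceZ₀ ⊆ spaceP₀ Γ ∧
    (∀ k ∈ spaceX₀, ∃ f ∈ maxwellSpace ∩ spaceZ₀, onCone f = coneGradient (divergence k)) := by
  refine ⟨Set.Subset.antisymm (fun f hf => ?_) ?_, ?_, ?_, fun k => exists_mem_maxwellSpace⟩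
  · obtain ⟨h, hh⟩ := exists_coneGradient_of_mem_spaceP₀ hΓ hf
    exact ⟨hf.1, h, hh, f, ((mem_spaceP_iff hΓ).1 hf.1).1, hh⟩
  · rintro f ⟨hf, h, hh, -⟩
    exact mem_spaceP₀_of_coneGradient hΓ ((mem_spaceP_iff hΓ).1 hf).1 hh
  · rintro h ⟨f, hf, hh⟩
    exact ⟨f, mem_spaceP₀_of_coneGradient hΓ hf hh, hh⟩
  · rintro f ⟨⟨-, k, -, hh⟩, hf⟩
    exact mem_spaceP₀_of_coneGradient hΓ hf hh
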